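/- Let $R$ be an associative ring with $1$. Classes of modules are closed under isomorphism. For a left or right $R$-module $N$ let $N^*=\mathrm{Hom}_{\mathbb Z}(N,\mathbb Q/\mathbb Z)$, a module on the other side, and for a class $\mathcal X$ of modules put $\mathcal X^*=\{N^*: N\in\mathcal X\}$. Let $\mathrm{Prod}(\mathcal X)$, respectively $\mathrm{Prod}^+(\mathcal X)$, be the class of all direct summands, respectively all pure submodules, of direct products of members of $\mathcal X$. A pair $(\mathcal S,\mathcal P)$, with $\mathcal S$ a class of left $R$-modules and $\mathcal P$ a class of right $R$-modules, is an almost dual pair if $\mathcal P=\mathrm{Prod}(\mathcal P)$, $\mathcal P$ is closed under pure-injective hulls, and for every left $R$-module $N$ one has $N\in\mathcal S$ if and only if $N^*\in\mathcal P$. Let $\mathcal B$ be an additive subcategory of the category of finitely presented left $R$-modules (a full subcategory closed under isomorphisms and finite direct sums, including $0$), let $\mathcal B'$ be a set of members of $\mathcal B$ that contains a representative of every isomorphism class of $\mathcal B$, and put $M=\bigoplus_{B\in\mathcal B'}B$. Let $(\mathcal S,\mathcal P)$ be the almost dual pair with $\mathcal P=\mathrm{Prod}^+(\mathcal B^*)$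 (so $\mathcal S$ is the class of all left $R$-modules $N$ with $N^*\in\mathrm{Prod}^+(\mathcal B^*)$). Then the following conditions are equivalent: (i) $\mathcal P=\mathrm{Prod}(\mathcal S^*)$ and $\mathcal S=\mathrm{Prod}(\mathcal P^*)$; (ii) the right $R$-module $M^*$ has finite length as a module over its endomorphism ring. -/

import Mathlib

open CategoryTheory
open scoped DirectSum

universe u

namespace AlmostDual

/-! Left `R`-modules are `R`-modules and right `R`-modules are `Rᵐᵒᵖ`-modules.
A class of modules is an `ObjectProperty` of the category of modules. -/

section Duals

variable (R : Type u) [Ring R]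

/-- The right `R`-module structure on `Hom_ℤ(M, ℚ/ℤ)` for a left `R`-module `M`:
`(f · r)(m) = f (r m)`. -/
abbrev rightModuleDual (M : Type u) [AddCommGroup M] [Module R M] :
    Module Rᵐᵒᵖ (CharacterModule M) where
  smul r f := AddMonoidHom.comp f (DistribSMul.toAddMonoidHom M r.unop)
  one_smul f := CharacterModule.ext _ fun x => congrArg f (one_smul R x)
  mul_smul r s f := CharacterModule.ext _ fun x => congrArg f (mul_smul s.unop r.unop x)
  smul_zero _ := CharacterModule.ext _ fun _ => rfl
  smul_add _ _ _ := CharacterModule.ext _ fun _ => rfl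
  add_smul r s f := CharacterModule.ext _ fun x =>
    (congrArg f (add_smul r.unop s.unop x)).trans (map_add f _ _)
  zero_smul f := CharacterModule.ext _ fun x =>
    (congrArg f (zero_smul R x)).trans (map_zero f)

/-- The left `R`-module structure on `Hom_ℤ(N, ℚ/ℤ)` for a right `R`-module `N`:
`(r · f)(n) = f (n r)`. -/
abbrev leftModuleDual (N : Type u) [AddCommGroup N] [Module Rᵐᵒᵖ N] :
    Module R (CharacterModule N) where
  smul r f := AddMonoidHom.comp f (DistribSMul.toAddMonoidHom N (MulOpposite.op r))
  one_smul f := CharacterModule.ext _ fun x => congrArg f (one_smul Rᵐᵒᵖ x)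
  mul_smul r s f := CharacterModule.ext _ fun x =>
    congrArg f (mul_smul (MulOpposite.op s) (MulOpposite.op r) x)
  smul_zero _ := CharacterModule.ext _ fun _ => rfl
  smul_add _ _ _ := CharacterModule.ext _ fun _ => rfl
  add_smul r s f := CharacterModule.ext _ fun x =>
    (congrArg f (add_smul (MulOpposite.op r) (MulOpposite.op s) x)).trans (map_add f _ _)
  zero_smul f := CharacterModule.ext _ fun x =>
    (congrArg f (zero_smul Rᵐᵒᵖ x)).trans (map_zero f)

variable {R}

/-- The dual `M^* = Hom_ℤ(M, ℚ/ℤ)` of a left module, a right module. -/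
def dualOfLeft (M : ModuleCat.{u} R) : ModuleCat.{u} Rᵐᵒᵖ :=
  @ModuleCat.of Rᵐᵒᵖ _ (CharacterModule M) _ (rightModuleDual R M)

/-- The dual `N^* = Hom_ℤ(N, ℚ/ℤ)` of a right module, a left module. -/
def dualOfRight (N : ModuleCat.{u} Rᵐᵒᵖ) : ModuleCat.{u} R :=
  @ModuleCat.of R _ (CharacterModule N) _ (leftModuleDual R N)

/-- The class `X^*` of duals of members of a class `X` of left modules (up to isomorphism). -/
def dualClassOfLeft (X : ObjectProperty (ModuleCat.{u} R)) :
    ObjectProperty (ModuleCat.{u} Rᵐᵒᵖ) :=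
  fun N => ∃ M : ModuleCat.{u} R, X M ∧ Nonempty (N ≃ₗ[Rᵐᵒᵖ] dualOfLeft M)

/-- The class `X^*` of duals of members of a class `X` of right modules (up to isomorphism). -/
def dualClassOfRight (X : ObjectProperty (ModuleCat.{u} Rᵐᵒᵖ)) :
    ObjectProperty (ModuleCat.{u} R) :=
  fun N => ∃ M : ModuleCat.{u} Rᵐᵒᵖ, X M ∧ Nonempty (N ≃ₗ[R] dualOfRight M)

end Duals

section Purity

variable {A : Type u} [Ring A]

/-- `f : N → L` is a pure monomorphism: every finite system of linear equations with constants
in `N` that has a solution in `L` has a solution in `N`. (The system `0 = b` with no unknowns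
shows that such an `f` is injective.) -/
def IsPureMono {N L : Type u} [AddCommGroup N] [Module A N] [AddCommGroup L] [Module A L]
    (f : N →ₗ[A] L) : Prop :=
  ∀ (m n : ℕ) (a : Matrix (Fin m) (Fin n) A) (b : Fin m → N),
    (∃ y : Fin n → L, ∀ i, ∑ j, a i j • y j = f (b i)) →
      ∃ x : Fin n → N, ∀ i, ∑ j, a i j • x j = b i

/-- `H` is pure-injective: maps to `H` extend along pure monomorphisms. -/
def IsPureInjective (H : ModuleCat.{u} A) : Prop :=
  ∀ (N L : ModuleCat.{u} A) (f : N →ₗ[A] L), IsPureMono f →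
    ∀ g : N →ₗ[A] H, ∃ h : L →ₗ[A] H, h ∘ₗ f = g

/-- `f : N → H` is a pure-injective hull (envelope) of `N`: a pure monomorphism to a pure-injective
module such that every endomorphism of `H` fixing `f` is an automorphism. -/
def IsPureInjectiveHull {N H : ModuleCat.{u} A} (f : N →ₗ[A] H) : Prop :=
  IsPureInjective H ∧ IsPureMono f ∧
    ∀ g : H →ₗ[A] H, g ∘ₗ f = f → Function.Bijective g

/-- `Prod X`: the direct summands of direct products of members of `X`. -/
def prodClosure (X : ObjectProperty (ModuleCat.{u} A)) : ObjectProperty (ModuleCat.{u} A) :=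
  fun N => ∃ (ι : Type u) (Y : ι → ModuleCat.{u} A), (∀ i, X (Y i)) ∧
    ∃ (s : N →ₗ[A] (∀ i, Y i)) (r : (∀ i, Y i) →ₗ[A] N), r ∘ₗ s = LinearMap.id

/-- `Prod⁺ X`: the pure submodules of direct products of members of `X`. -/
def prodPlusClosure (X : ObjectProperty (ModuleCat.{u} A)) : ObjectProperty (ModuleCat.{u} A) :=
  fun N => ∃ (ι : Type u) (Y : ι → ModuleCat.{u} A), (∀ i, X (Y i)) ∧
    ∃ f : N →ₗ[A] (∀ i, Y i), IsPureMono f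

/-- `B` is (the class of objects of) an additive subcategory of the category of finitely presented
modules: a full subcategory, closed under isomorphism and finite direct sums. -/
structure IsAdditiveSubcategory (B : ObjectProperty (ModuleCat.{u} A)) : Prop where
  finitePresentation : ∀ N, B N → Module.FinitePresentation A N
  of_iso : ∀ N L : ModuleCat.{u} A, Nonempty (N ≃ₗ[A] L) → B N → B L
  zero : B (ModuleCat.of A PUnit.{u + 1})
  sum : ∀ N L : ModuleCat.{u} A, B N → B L → B (ModuleCat.of A (N × L))

end Purity

/-- `(S, P)` is an almost dual pair over `R`: `P = Prod P`, the class `P` is closed under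
pure-injective hulls, and `M ∈ S` if and only if `M^* ∈ P`. -/
structure IsAlmostDualPair {R : Type u} [Ring R] (S : ObjectProperty (ModuleCat.{u} R))
    (P : ObjectProperty (ModuleCat.{u} Rᵐᵒᵖ)) : Prop where
  eq_prod : P = prodClosure P
  hull : ∀ (N H : ModuleCat.{u} Rᵐᵒᵖ) (f : N →ₗ[Rᵐᵒᵖ] H), P N → IsPureInjectiveHull f → P H
  mem_iff : ∀ M : ModuleCat.{u} R, S M ↔ P (dualOfLeft M)

end AlmostDual

/-!
Both conditions say that the definable subgroups of `M^*`, those cut out by positive primitive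
formulas `∃ y, a x + b y = 0`, satisfy the ascending and the descending chain condition.

The tool is the elementary duality of formulas: for `φ` over `R` there is a formula `φ.dual` over
`Rᵐᵒᵖ` such that `φ.dual` defines in `N^*` the annihilator of `φ(N)`, and conversely `φ(Y^*)` is
the annihilator of what `φ.dual` defines in `Y` (`mem_sol_dual_iff_pair_eq_zero`,
`mem_sol_iff_pair_dual_eq_zero`). Both follow from the divisibility of `ℚ/ℤ`. So chain conditions
change direction under duality, and an implication of formulas valid in `M` is passed on to `M^*`
in the reversed order. Purity means reflecting the truth of formulas (`isPureMono_iff_sol`), and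
two sources of pure-injective modules are obtained from algebraic compactness
(`IsAlgebraicallyCompact.isPureInjective`): dual modules, and modules with the descending chain
condition.

Suppose `P = Prod (S^*)` and `S = Prod (P^*)`. Then all members of `S` and `P` are
pure-injective. As `S` and `P` contain `M^(ℕ)` and `(M^*)^(ℕ)`, which are pure in `M^ℕ` and
`(M^*)^ℕ`, these split, and `M` and `M^*` have the descending chain condition
(`PPDescending.of_retraction`). By duality `M^*` also has the ascending one. In a pure-injective
module with both chain conditions every endosubmodule is definable
(`IsPureInjective.exists_solOne_eq`), so `M^*` has finite length over its endomorphism ring.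

Conversely, definable subgroups are endosubmodules, so finite endolength of `M^*` gives all chain
conditions for `M` and `M^*`. Members of `P` satisfy the implications valid in `M^*`, hence inherit
its descending chain condition and are pure-injective; being pure in a product of duals of members
of `B`, they are summands of it, which gives `P = Prod (S^*)`. Members of `S` satisfy the
implications valid in `M`, hence are pure-injective, and each of them splits off its double dual.
For `Prod (P^*) ⊆ S` the point is that every module satisfying the implications valid in `M` lies
in `S`: by the ascending chain condition on `M`, `φ(M)` is the sum of finitely many `ψ(M)`, where
each `ψ` generates the positive primitive type of a tuple in some finitely presented `X i`, and
this equality of formulas passes to any such module (`InDefinableClosure.isPPCover`).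
-/

namespace AlmostDual

/-! ### Characters of abelian groups -/

/-- Since `ℚ/ℤ` is divisible, a character that vanishes on the kernel of `f` factors
through `f`. -/
theorem exists_character_comp_eq {G N : Type*} [AddCommGroup G] [AddCommGroup N] (f : G →+ N)
    (χ : G →+ AddCircle (1 : ℚ)) (h : ∀ g, f g = 0 → χ g = 0) :
    ∃ χ' : N →+ AddCircle (1 : ℚ), ∀ g, χ' (f g) = χ g := by
  have hle : f.ker ≤ χ.ker := fun g hg => h g hg
  obtain ⟨χ', hχ'⟩ := CharacterModule.dual_surjective_of_injective
    (QuotientAddGroup.kerLift f).toIntLinearMap (QuotientAddGroup.kerLift_injective f)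
    (QuotientAddGroup.lift f.ker χ hle)
  exact ⟨χ', fun g => DFunLike.congr_fun hχ' (QuotientAddGroup.mk' f.ker g)⟩

theorem exists_character_eq_zero_ne_zero {G : Type*} [AddCommGroup G] (K : AddSubgroup G) {x : G}
    (hx : x ∉ K) : ∃ χ : G →+ AddCircle (1 : ℚ), (∀ y ∈ K, χ y = 0) ∧ χ x ≠ 0 := by
  have hne : (QuotientAddGroup.mk' K x) ≠ 0 := fun h => hx ((QuotientAddGroup.eq_zero_iff x).1 h)
  obtain ⟨c, hc⟩ := CharacterModule.exists_character_apply_ne_zero_of_ne_zero hne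
  refine ⟨AddMonoidHom.comp c (QuotientAddGroup.mk' K), fun y hy => ?_, hc⟩
  have : QuotientAddGroup.mk' K y = 0 := (QuotientAddGroup.eq_zero_iff y).2 hy
  exact (congrArg c this).trans (map_zero c)

/-! ### Matrices acting on tuples of module elements -/

section Act

variable {A : Type*} [Ring A] {N L : Type*} [AddCommGroup N] [Module A N] [AddCommGroup L]
  [Module A L] {m n k : Type*} [Fintype n] [Fintype k]

/-- The additive map `N^n → N^m` given by an `m × n` matrix over `A`. -/
def act (a : Matrix m n A) : (n → N) →+ (m → N) where
  toFun x i := ∑ j, a i j • x j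
  map_zero' := by ext; simp
  map_add' x y := by ext; simp [Finset.sum_add_distrib]

theorem act_apply (a : Matrix m n A) (x : n → N) (i : m) : act a x i = ∑ j, a i j • x j := rfl

theorem act_comp (f : N →ₗ[A] L) (a : Matrix m n A) (x : n → N) :
    act a (fun j => f (x j)) = fun i => f (act a x i) := by
  ext; simp [act_apply]

@[simp] theorem act_zero_matrix (x : n → N) : act (0 : Matrix m n A) x = 0 := by
  ext; simp [act_apply]

@[simp] theorem act_neg_matrix (a : Matrix m n A) (x : n → N) : act (-a) x = -act a x := by
  ext; simp [act_apply]

@[simp] theorem act_one [DecidableEq n] (x : n → N) : act (1 : Matrix n n A) x = x := by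
  ext i; simp [act_apply, Matrix.one_apply, ite_smul]

theorem act_fromCols (a : Matrix m n A) (b : Matrix m k A) (x : n ⊕ k → N) :
    act (Matrix.fromCols a b) x = act a (x ∘ Sum.inl) + act b (x ∘ Sum.inr) := by
  ext; simp [act_apply]

theorem act_fromRows {m' : Type*} (a : Matrix m n A) (b : Matrix m' n A) (x : n → N) :
    act (Matrix.fromRows a b) x = Sum.elim (act a x) (act b x) := by
  ext i; cases i <;> simp [act_apply]

end Act

theorem sumElim_eq_zero_iff {α β N : Type*} [Zero N] {f : α → N} {g : β → N} :
    Sum.elim f g = 0 ↔ f = 0 ∧ g = 0 := by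
  rw [← Sum.elim_zero_zero, Sum.elim_eq_iff]

/-! ### Positive primitive formulas -/

/-- A positive primitive formula in the free variables `x : n`, namely
`∃ y, a x + b y = 0` for a finite system of linear equations over `A`. -/
structure PPFormula (A : Type u) (n : Type) where
  /-- the bound variables -/
  var : Type
  /-- the equations -/
  eqn : Type
  [fintypeVar : Fintype var]
  [fintypeEqn : Fintype eqn]
  /-- the coefficients of the free variables -/
  a : Matrix eqn n A
  /-- the coefficients of the bound variables -/
  b : Matrix eqn var A

namespace PPFormula

attribute [instance] PPFormula.fintypeVar PPFormula.fintypeEqn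

variable {A : Type u} [Ring A] {n : Type} [Fintype n]

/-- The subgroup of `N^n` that a positive primitive formula defines in the module `N`. -/
def sol (φ : PPFormula A n) (N : Type*) [AddCommGroup N] [Module A N] : AddSubgroup (n → N) where
  carrier := {x | ∃ y, act φ.a x + act φ.b y = 0}
  zero_mem' := ⟨0, by simp⟩
  add_mem' := by
    rintro x x' ⟨y, hy⟩ ⟨y', hy'⟩
    exact ⟨y + y', by rw [map_add, map_add, add_add_add_comm, hy, hy', add_zero]⟩
  neg_mem' := by
    rintro x ⟨y, hy⟩
    exact ⟨-y, by rw [map_neg, map_neg, ← neg_add, hy, neg_zero]⟩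

section

variable {N L : Type*} [AddCommGroup N] [Module A N] [AddCommGroup L] [Module A L]

theorem mem_sol {φ : PPFormula A n} {x : n → N} :
    x ∈ φ.sol N ↔ ∃ y, act φ.a x + act φ.b y = 0 := Iff.rfl

theorem map_mem_sol {φ : PPFormula A n} (f : N →ₗ[A] L) {x : n → N} (hx : x ∈ φ.sol N) :
    (fun j => f (x j)) ∈ φ.sol L := by
  obtain ⟨y, hy⟩ := hx
  refine ⟨fun j => f (y j), ?_⟩
  rw [act_comp, act_comp]
  ext i
  simpa using congrArg f (congrFun hy i)

/-- The conjunction of two formulas. -/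
def inf (φ ψ : PPFormula A n) : PPFormula A n where
  var := φ.var ⊕ ψ.var
  eqn := φ.eqn ⊕ ψ.eqn
  a := Matrix.fromRows φ.a ψ.a
  b := Matrix.fromRows (Matrix.fromCols φ.b 0) (Matrix.fromCols 0 ψ.b)

theorem mem_sol_inf {φ ψ : PPFormula A n} {x : n → N} :
    x ∈ (φ.inf ψ).sol N ↔ x ∈ φ.sol N ∧ x ∈ ψ.sol N := by
  simp only [mem_sol, inf]
  simp only [act_fromRows, act_fromCols, act_zero_matrix, add_zero, zero_add,
    ← Sum.elim_add_add, sumElim_eq_zero_iff]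
  constructor
  · rintro ⟨y, h₁, h₂⟩
    exact ⟨⟨_, h₁⟩, ⟨_, h₂⟩⟩
  · rintro ⟨⟨y, h₁⟩, ⟨z, h₂⟩⟩
    exact ⟨Sum.elim y z, h₁, h₂⟩

variable (A n) in
open Classical in
/-- The formula `x = 0`. -/
noncomputable def bot : PPFormula A n where
  var := Empty
  eqn := n
  a := 1
  b := 0

theorem sol_bot : (bot A n).sol N = ⊥ := by
  ext x
  simp only [mem_sol, bot]
  simp only [act_one, act_zero_matrix, add_zero, exists_const, AddSubgroup.mem_bot]

/-- The sum of two formulas, `∃ u, φ(u) ∧ ψ(x - u)`. -/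
def sup (φ ψ : PPFormula A n) : PPFormula A n where
  var := n ⊕ (φ.var ⊕ ψ.var)
  eqn := φ.eqn ⊕ ψ.eqn
  a := Matrix.fromRows 0 ψ.a
  b := Matrix.fromRows (Matrix.fromCols φ.a (Matrix.fromCols φ.b 0))
    (Matrix.fromCols (-ψ.a) (Matrix.fromCols 0 ψ.b))

theorem sol_sup (φ ψ : PPFormula A n) : (φ.sup ψ).sol N = φ.sol N ⊔ ψ.sol N := by
  ext x
  simp only [mem_sol, sup]
  simp only [act_fromRows, act_fromCols, act_zero_matrix, add_zero, zero_add, act_neg_matrix,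
    ← Sum.elim_add_add, sumElim_eq_zero_iff]
  rw [AddSubgroup.mem_sup]
  constructor
  · rintro ⟨y, h₁, h₂⟩
    refine ⟨y ∘ Sum.inl, ⟨_, h₁⟩, x - y ∘ Sum.inl, ⟨(y ∘ Sum.inr) ∘ Sum.inr, ?_⟩, by simp⟩
    rw [map_sub, ← h₂]
    abel
  · rintro ⟨v, ⟨y, hy⟩, w, ⟨z, hz⟩, rfl⟩
    refine ⟨Sum.elim v (Sum.elim y z), hy, ?_⟩
    change act ψ.a (v + w) + (-act ψ.a v + act ψ.b z) = 0
    rw [map_add, ← hz]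
    abel

end

theorem mem_sol_pi {φ : PPFormula A n} {ι : Type*} {Y : ι → Type*} [∀ i, AddCommGroup (Y i)]
    [∀ i, Module A (Y i)] {x : n → ∀ i, Y i} :
    x ∈ φ.sol (∀ i, Y i) ↔ ∀ i, (fun j => x j i) ∈ φ.sol (Y i) := by
  constructor
  · intro h i
    exact map_mem_sol (LinearMap.proj i) h
  · intro h
    choose y hy using h
    refine ⟨fun k i => y i k, ?_⟩
    ext e i
    simpa [act_apply] using congrFun (hy i) e

end PPFormula

/-! ### Duality of formulas -/

/-- `N'` is the character group of the `A`-module `N`, with the `A'`-module structure that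
comes from the one of `N` along `σ : A ≃ A'`. It covers the duals of left modules as well as
those of right modules, with `σ` the tautological bijection between a ring and its opposite. -/
structure CharDuality {A A' : Type*} [Ring A] [Ring A'] (σ : A ≃ A') (N N' : Type*)
    [AddCommGroup N] [Module A N] [AddCommGroup N'] [Module A' N'] where
  /-- the identification with the character group -/
  e : N' ≃+ (N →+ AddCircle (1 : ℚ))
  smul_apply : ∀ (a : A) (f : N') (x : N), e (σ a • f) x = e f (a • x)

namespace CharDuality

variable {A A' : Type u} [Ring A] [Ring A'] {σ : A ≃ A'} {N N' : Type*}
  [AddCommGroup N] [Module A N] [AddCommGroup N'] [Module A' N'] (D : CharDuality σ N N')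
  {m n : Type*} [Fintype m] [Fintype n]

/-- The pairing `(N')^n × N^n → ℚ/ℤ`. -/
def pair : (n → N') →+ (n → N) →+ AddCircle (1 : ℚ) :=
  AddMonoidHom.mk' (fun f => AddMonoidHom.mk' (fun x => ∑ i, D.e (f i) (x i))
    (fun x y => by simp [Finset.sum_add_distrib]))
    (fun f g => by
      ext x
      simp [Finset.sum_add_distrib])

theorem pair_apply (f : n → N') (x : n → N) : D.pair f x = ∑ i, D.e (f i) (x i) := rfl

theorem pair_act (a : Matrix m n A) (w : m → N') (z : n → N) :
    D.pair (act (a.transpose.map σ) w) z = D.pair w (act a z) := by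
  simp only [pair_apply, act_apply, map_sum, AddMonoidHom.finsetSum_apply, Matrix.map_apply,
    Matrix.transpose_apply]
  rw [Finset.sum_comm]
  refine Finset.sum_congr rfl fun i _ => Finset.sum_congr rfl fun j _ => ?_
  exact D.smul_apply _ _ _

theorem pair_act_symm (a : Matrix m n A') (x : n → N') (w : m → N) :
    D.pair (act a x) w = D.pair x (act (a.transpose.map σ.symm) w) := by
  have h : (a.transpose.map σ.symm).transpose.map σ = a := by
    ext i j
    simp
  rw [← pair_act, h]

theorem ext_pair {f g : n → N'} (h : ∀ x, D.pair f x = D.pair g x) : f = g := by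
  classical
  ext i
  apply D.e.injective
  ext x
  have := h (Pi.single i x)
  simpa [pair_apply, Pi.single_apply, apply_ite] using this

theorem exists_pair_eq (χ : (n → N) →+ AddCircle (1 : ℚ)) :
    ∃ f : n → N', ∀ x, D.pair f x = χ x := by
  classical
  refine ⟨fun i => D.e.symm (AddMonoidHom.comp χ (AddMonoidHom.single (fun _ => N) i)),
    fun x => ?_⟩
  conv_rhs => rw [← Finset.univ_sum_single x, map_sum]
  simp only [pair_apply, AddEquiv.apply_symm_apply]
  rfl

theorem exists_pair_ne_zero (K : AddSubgroup (n → N)) {x : n → N} (hx : x ∉ K) :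
    ∃ f : n → N', (∀ y ∈ K, D.pair f y = 0) ∧ D.pair f x ≠ 0 := by
  obtain ⟨χ, h₁, h₂⟩ := exists_character_eq_zero_ne_zero K hx
  obtain ⟨f, hf⟩ := D.exists_pair_eq χ
  exact ⟨f, fun y hy => (hf y).trans (h₁ y hy), by rwa [hf]⟩

end CharDuality

namespace PPFormula

variable {A A' : Type u} [Ring A'] {n : Type} [Fintype n]

open Classical in
/-- The elementary dual `∃ w, x + aᵀ w = 0 ∧ bᵀ w = 0` of the formula `∃ y, a x + b y = 0`, for
modules on the other side. -/
noncomputable def dual (σ : A → A') (φ : PPFormula A n) : PPFormula A' n where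
  var := φ.eqn
  eqn := n ⊕ φ.var
  a := Matrix.fromRows 1 0
  b := Matrix.fromRows (φ.a.transpose.map σ) (φ.b.transpose.map σ)

theorem mem_sol_dual {σ : A → A'} {φ : PPFormula A n} {N : Type*} [AddCommGroup N] [Module A' N]
    {x : n → N} : x ∈ (φ.dual σ).sol N ↔
      ∃ w, x + act (φ.a.transpose.map σ) w = 0 ∧ act (φ.b.transpose.map σ) w = 0 := by
  simp only [mem_sol, dual]
  simp only [act_fromRows, act_zero_matrix, zero_add, act_one, ← Sum.elim_add_add,
    sumElim_eq_zero_iff]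

variable [Ring A] {σ : A ≃ A'} {N N' : Type*} [AddCommGroup N] [Module A N] [AddCommGroup N']
  [Module A' N'] (D : CharDuality σ N N')

/-- The dual formula defines in the dual module the annihilator of the original subgroup. -/
theorem mem_sol_dual_iff_pair_eq_zero {φ : PPFormula A n} {x : n → N'} :
    x ∈ (φ.dual σ).sol N' ↔ ∀ z ∈ φ.sol N, D.pair x z = 0 := by
  rw [mem_sol_dual]
  constructor
  · rintro ⟨w, h₁, h₂⟩ z ⟨y, hy⟩
    rw [eq_neg_of_add_eq_zero_left h₁, map_neg, AddMonoidHom.neg_apply, D.pair_act,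
      eq_neg_of_add_eq_zero_left hy, map_neg, neg_neg, ← D.pair_act, h₂, map_zero,
      AddMonoidHom.zero_apply]
  · intro h
    -- the character `(z, y) ↦ ⟨x, z⟩` vanishes on the kernel of `(z, y) ↦ a z + b y`
    obtain ⟨χ, hχ⟩ := exists_character_comp_eq
      (AddMonoidHom.coprod (act (N := N) φ.a) (act (N := N) φ.b))
      (AddMonoidHom.comp (D.pair x) (AddMonoidHom.fst (n → N) (φ.var → N)))
      (fun g hg => h g.1 ⟨g.2, hg⟩)
    obtain ⟨w, hw⟩ := D.exists_pair_eq χ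
    have key : ∀ z y, D.pair w (act φ.a z + act φ.b y) = D.pair x z := fun z y =>
      (hw _).trans (hχ (z, y))
    refine ⟨-w, ?_, ?_⟩
    · rw [map_neg, ← sub_eq_add_neg, sub_eq_zero]
      refine D.ext_pair fun z => ?_
      rw [D.pair_act, ← key z 0, map_zero, add_zero]
    · refine D.ext_pair fun y => ?_
      rw [D.pair_act, map_neg, AddMonoidHom.neg_apply, map_zero, AddMonoidHom.zero_apply]
      simpa using key 0 y

/-- A formula defines in the dual module the annihilator of what its dual formula defines. -/
theorem mem_sol_iff_pair_dual_eq_zero {φ : PPFormula A' n} {x : n → N'} :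
    x ∈ φ.sol N' ↔ ∀ z ∈ (φ.dual σ.symm).sol N, D.pair x z = 0 := by
  constructor
  · rintro ⟨y, hy⟩ z hz
    obtain ⟨w, h₁, h₂⟩ := mem_sol_dual.1 hz
    rw [eq_neg_of_add_eq_zero_left h₁, map_neg, ← D.pair_act_symm,
      eq_neg_of_add_eq_zero_left hy, map_neg, AddMonoidHom.neg_apply, neg_neg, D.pair_act_symm,
      h₂, map_zero]
  · intro h
    obtain ⟨χ, hχ⟩ := exists_character_comp_eq (act (N := N) (φ.b.transpose.map σ.symm))
      (D.pair (act φ.a x)) (fun w hw => by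
        have := h _ (mem_sol_dual.2 ⟨w, neg_add_cancel _, hw⟩)
        rwa [map_neg, neg_eq_zero, ← D.pair_act_symm] at this)
    obtain ⟨y, hy⟩ := D.exists_pair_eq χ
    refine ⟨-y, ?_⟩
    rw [map_neg, ← sub_eq_add_neg, sub_eq_zero]
    refine D.ext_pair fun w => ?_
    rw [D.pair_act_symm φ.b, hy, hχ]

theorem sol_dual_le_iff (D : CharDuality σ N N') {φ ψ : PPFormula A n} :
    (φ.dual σ).sol N' ≤ (ψ.dual σ).sol N' ↔ ψ.sol N ≤ φ.sol N := by
  constructor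
  · intro h x hx
    by_contra hn
    obtain ⟨f, h₁, h₂⟩ := D.exists_pair_ne_zero _ hn
    exact h₂ ((mem_sol_dual_iff_pair_eq_zero D).1
      (h ((mem_sol_dual_iff_pair_eq_zero D).2 h₁)) x hx)
  · intro h x hx
    exact (mem_sol_dual_iff_pair_eq_zero D).2 fun z hz =>
      (mem_sol_dual_iff_pair_eq_zero D).1 hx z (h hz)

theorem sol_le_iff_dual_le (D : CharDuality σ N N') {φ ψ : PPFormula A' n} :
    φ.sol N' ≤ ψ.sol N' ↔ (ψ.dual σ.symm).sol N ≤ (φ.dual σ.symm).sol N := by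
  constructor
  · intro h x hx
    by_contra hn
    obtain ⟨f, h₁, h₂⟩ := D.exists_pair_ne_zero _ hn
    exact h₂ ((mem_sol_iff_pair_dual_eq_zero D).1
      (h ((mem_sol_iff_pair_dual_eq_zero D).2 h₁)) x hx)
  · intro h x hx
    exact (mem_sol_iff_pair_dual_eq_zero D).2 fun z hz =>
      (mem_sol_iff_pair_dual_eq_zero D).1 hx z (h hz)

end PPFormula

variable {R : Type u} [Ring R]

/-- `M^*` as the dual of the left module `M`. -/
def charDualityLeft (M : ModuleCat.{u} R) :
    CharDuality (MulOpposite.opEquiv (α := R)) M (dualOfLeft M) where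
  e := AddEquiv.refl _
  smul_apply _ _ _ := rfl

/-- `N^*` as the dual of the right module `N`. -/
def charDualityRight (N : ModuleCat.{u} Rᵐᵒᵖ) :
    CharDuality (MulOpposite.opEquiv (α := R)).symm N (dualOfRight N) where
  e := AddEquiv.refl _
  smul_apply _ _ _ := rfl

/-! ### Pure monomorphisms -/

section Pure

variable {A : Type u} [Ring A] {N L K : Type u} [AddCommGroup N] [Module A N] [AddCommGroup L]
  [Module A L] [AddCommGroup K] [Module A K]

theorem isPureMono_iff {f : N →ₗ[A] L} :
    IsPureMono f ↔ ∀ (m n : Type) [Fintype m] [Fintype n] (a : Matrix m n A) (b : m → N),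
      (∃ y : n → L, act a y = fun i => f (b i)) → ∃ x : n → N, act a x = b := by
  constructor
  · rintro h m n _ _ a b ⟨y, hy⟩
    let em := Fintype.equivFin m
    let en := Fintype.equivFin n
    obtain ⟨x, hx⟩ := h _ _ (a.submatrix em.symm en.symm) (b ∘ em.symm) ⟨y ∘ en.symm, fun i => by
      rw [Function.comp_apply, ← congrFun hy, act_apply]
      exact en.symm.sum_comp (fun j => a (em.symm i) j • y j)⟩
    refine ⟨x ∘ en, funext fun i => ?_⟩
    have := hx (em i)
    simp only [Matrix.submatrix_apply, Equiv.symm_apply_apply, Function.comp_apply] at this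
    rw [← this, act_apply, ← en.symm.sum_comp]
    simp
  · rintro h m n a b ⟨y, hy⟩
    obtain ⟨x, hx⟩ := h _ _ a b ⟨y, funext hy⟩
    exact ⟨x, congrFun hx⟩

theorem isPureMono_iff_sol {f : N →ₗ[A] L} :
    IsPureMono f ↔ ∀ (n : Type) [Fintype n] (φ : PPFormula A n) (x : n → N),
      (fun j => f (x j)) ∈ φ.sol L → x ∈ φ.sol N := by
  rw [isPureMono_iff]
  constructor
  · rintro h n _ φ x ⟨y, hy⟩
    obtain ⟨z, hz⟩ := h _ _ φ.b (-act φ.a x) ⟨y, by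
      rw [eq_neg_of_add_eq_zero_right hy, act_comp]
      ext
      simp⟩
    exact ⟨z, by rw [hz, add_neg_cancel]⟩
  · classical
    rintro h m n _ _ a b ⟨y, hy⟩
    obtain ⟨z, hz⟩ := h m ⟨n, m, 1, a⟩ b ⟨-y, by simp [hy]⟩
    refine ⟨-z, ?_⟩
    rw [act_one] at hz
    rw [map_neg, eq_neg_of_add_eq_zero_left hz]

theorem IsPureMono.comp {g : L →ₗ[A] K} {f : N →ₗ[A] L} (hg : IsPureMono g) (hf : IsPureMono f) :
    IsPureMono (g ∘ₗ f) :=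
  isPureMono_iff_sol.2 fun n _ φ x h =>
    isPureMono_iff_sol.1 hf n φ x (isPureMono_iff_sol.1 hg n φ _ h)

theorem isPureMono_of_leftInverse {f : N →ₗ[A] L} {r : L →ₗ[A] N} (h : r ∘ₗ f = LinearMap.id) :
    IsPureMono f :=
  isPureMono_iff_sol.2 fun n _ φ x hx => by
    have := PPFormula.map_mem_sol r hx
    simpa [← LinearMap.comp_apply, h] using this

theorem isPureMono_of_linearEquiv (e : N ≃ₗ[A] L) : IsPureMono e.toLinearMap :=
  isPureMono_of_leftInverse (r := e.symm.toLinearMap) (by ext; simp)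

theorem isPureMono_finsupp (κ : Type u) :
    IsPureMono (Finsupp.lcoeFun : (κ →₀ N) →ₗ[A] (κ → N)) := by
  classical
  refine isPureMono_iff.2 fun m n _ _ a b => ?_
  rintro ⟨y, hy⟩
  -- cut a solution off outside the union of the supports of the constants
  let s : Finset κ := Finset.univ.biUnion fun i => (b i).support
  refine ⟨fun j => Finsupp.onFinset s (fun k => if k ∈ s then y j k else 0)
    fun k hk => by_contra fun h => hk (if_neg h), funext fun i => Finsupp.ext fun k => ?_⟩
  have hk := congrFun (congrFun hy i) k
  simp only [act_apply, Finset.sum_apply, Pi.smul_apply, Finsupp.lcoeFun_apply] at hk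
  simp only [act_apply, Finsupp.finsetSum_apply, Finsupp.smul_apply, Finsupp.onFinset_apply]
  by_cases h : k ∈ s
  · simpa [h] using hk
  · have : b i k = 0 := by
      by_contra hb
      exact h (Finset.mem_biUnion.2 ⟨i, Finset.mem_univ _, Finsupp.mem_support_iff.2 hb⟩)
    simp [h, this]

end Pure

/-! ### Chain conditions on definable subgroups -/

section Chain

/-- `N` satisfies every implication between positive primitive formulas that holds in `M`: it
belongs to the definable class generated by `M`. -/
def InDefinableClosure (A : Type u) [Ring A] (M N : Type*) [AddCommGroup M] [Module A M]
    [AddCommGroup N] [Module A N] : Prop :=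
  ∀ (n : Type) [Fintype n] (φ ψ : PPFormula A n), φ.sol M ≤ ψ.sol M → φ.sol N ≤ ψ.sol N

/-- The descending chain condition on subgroups of `N^n` defined by positive primitive formulas. -/
def PPDescending (A : Type u) [Ring A] (n : Type) [Fintype n] (N : Type*) [AddCommGroup N]
    [Module A N] : Prop :=
  WellFounded fun φ ψ : PPFormula A n => φ.sol N < ψ.sol N

/-- The ascending chain condition on subgroups of `N^n` defined by positive primitive formulas. -/
def PPAscending (A : Type u) [Ring A] (n : Type) [Fintype n] (N : Type*) [AddCommGroup N]
    [Module A N] : Prop :=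
  WellFounded fun φ ψ : PPFormula A n => ψ.sol N < φ.sol N

variable {A : Type u} [Ring A] {n : Type} [Fintype n]

/-- The descending chain condition is inherited along the definable class. -/
theorem PPDescending.of_inDefinableClosure {M N : Type*} [AddCommGroup M] [Module A M]
    [AddCommGroup N] [Module A N] (hM : PPDescending A n M) (h : InDefinableClosure A M N) :
    PPDescending A n N := by
  rw [PPDescending, wellFounded_iff_isEmpty_descending_chain] at hM ⊢
  constructor
  rintro ⟨f, hf⟩
  -- the chain need not descend in `M`, but the finite conjunctions of its members do
  let χ : ℕ → PPFormula A n := fun k => Nat.rec (f 0) (fun k c => (f (k + 1)).inf c) k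
  have hχ : ∀ k, (χ k).sol N = (f k).sol N := by
    intro k
    induction k with
    | zero => rfl
    | succ k ih =>
      ext x
      change x ∈ ((f (k + 1)).inf (χ k)).sol N ↔ _
      rw [PPFormula.mem_sol_inf, ih]
      exact and_iff_left_of_imp fun hx => (hf k).le hx
  refine hM.false ⟨χ, fun k => lt_of_le_not_ge
    (fun x hx => (PPFormula.mem_sol_inf.1 hx).2) fun hle => ?_⟩
  have := h n _ _ hle
  rw [hχ, hχ (k + 1)] at this
  exact (hf k).not_ge this

theorem InDefinableClosure.trans {L M N : Type*} [AddCommGroup L] [Module A L] [AddCommGroup M]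
    [Module A M] [AddCommGroup N] [Module A N] (h : InDefinableClosure A L M)
    (h' : InDefinableClosure A M N) : InDefinableClosure A L N :=
  fun n _ φ ψ hle => h' n φ ψ (h n φ ψ hle)

theorem InDefinableClosure.of_isPureMono {N L : Type u} [AddCommGroup N] [Module A N]
    [AddCommGroup L] [Module A L] {f : N →ₗ[A] L} (hf : IsPureMono f) :
    InDefinableClosure A L N :=
  fun n _ _ ψ hle x hx => isPureMono_iff_sol.1 hf n ψ x (hle (PPFormula.map_mem_sol f hx))

theorem InDefinableClosure.pi {M : Type*} [AddCommGroup M] [Module A M] {ι : Type*}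
    {Y : ι → Type*} [∀ i, AddCommGroup (Y i)] [∀ i, Module A (Y i)]
    (h : ∀ i, InDefinableClosure A M (Y i)) : InDefinableClosure A M (∀ i, Y i) :=
  fun n _ φ ψ hle _ hx => PPFormula.mem_sol_pi.2 fun i =>
    h i n φ ψ hle (PPFormula.mem_sol_pi.1 hx i)

section

variable {A' : Type u} [Ring A'] {σ : A ≃ A'} {M M' N N' : Type*}
  [AddCommGroup N] [Module A N] [AddCommGroup N'] [Module A' N']
  [AddCommGroup M] [Module A M] [AddCommGroup M'] [Module A' M']

theorem PPAscending.of_dual (D : CharDuality σ N N') (h : PPDescending A' n N') :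
    PPAscending A n N :=
  Subrelation.wf (fun {φ ψ} (hlt : ψ.sol N < φ.sol N) =>
    (lt_iff_le_not_ge.2 ⟨(φ.sol_dual_le_iff D).2 hlt.le,
      fun hle => hlt.not_ge ((ψ.sol_dual_le_iff D).1 hle)⟩ :
        (φ.dual σ).sol N' < (ψ.dual σ).sol N'))
    (InvImage.wf (fun φ : PPFormula A n => φ.dual σ) h)

theorem PPDescending.of_dual (D : CharDuality σ N N') (h : PPAscending A' n N') :
    PPDescending A n N :=
  Subrelation.wf (fun {φ ψ} (hlt : φ.sol N < ψ.sol N) =>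
    (lt_iff_le_not_ge.2 ⟨(ψ.sol_dual_le_iff D).2 hlt.le,
      fun hle => hlt.not_ge ((φ.sol_dual_le_iff D).1 hle)⟩ :
        (ψ.dual σ).sol N' < (φ.dual σ).sol N'))
    (InvImage.wf (fun φ : PPFormula A n => φ.dual σ) h)

theorem PPAscending.dual (D : CharDuality σ N N') (h : PPDescending A n N) :
    PPAscending A' n N' :=
  Subrelation.wf (fun {φ ψ} (hlt : ψ.sol N' < φ.sol N') =>
    (lt_iff_le_not_ge.2 ⟨(ψ.sol_le_iff_dual_le D).1 hlt.le,
      fun hle => hlt.not_ge ((φ.sol_le_iff_dual_le D).2 hle)⟩ :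
        (φ.dual σ.symm).sol N < (ψ.dual σ.symm).sol N))
    (InvImage.wf (fun φ : PPFormula A' n => φ.dual σ.symm) h)

theorem InDefinableClosure.dual (D : CharDuality σ M M') (D' : CharDuality σ N N')
    (h : InDefinableClosure A M N) : InDefinableClosure A' M' N' :=
  fun n _ _ _ hle => (PPFormula.sol_le_iff_dual_le D').2
    (h n _ _ ((PPFormula.sol_le_iff_dual_le D).1 hle))

theorem InDefinableClosure.of_dual (D : CharDuality σ M M') (D' : CharDuality σ N N')
    (h : InDefinableClosure A' M' N') : InDefinableClosure A M N :=
  fun n _ _ _ hle => (PPFormula.sol_dual_le_iff D').1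
    (h n _ _ ((PPFormula.sol_dual_le_iff D).2 hle))

/-- If `N'` satisfies the implications valid in `M^*`, then `(N')^*` satisfies those valid in
`M`. -/
theorem InDefinableClosure.dual_of_dual {N'' : Type*} [AddCommGroup N''] [Module A N'']
    (D : CharDuality σ M M') (D' : CharDuality σ.symm N' N'') (h : InDefinableClosure A' M' N') :
    InDefinableClosure A M N'' :=
  fun n _ _ _ hle => (PPFormula.sol_le_iff_dual_le D').2
    (h n _ _ ((PPFormula.sol_dual_le_iff D).2 hle))

end

/-- If `H^(ℕ)` is a direct summand of `H^ℕ`, then `H` has the descending chain condition on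
definable subgroups. -/
theorem PPDescending.of_retraction {H : Type u} [AddCommGroup H] [Module A H]
    (r : (ULift.{u} ℕ → H) →ₗ[A] (ULift.{u} ℕ →₀ H)) (hr : r ∘ₗ Finsupp.lcoeFun = LinearMap.id) :
    PPDescending A n H := by
  rw [PPDescending, wellFounded_iff_isEmpty_descending_chain]
  constructor
  rintro ⟨f, hf⟩
  have hanti : Antitone fun k => (f k).sol H := antitone_nat_of_succ_le fun k => (hf k).le
  choose x hx hx' using fun k => SetLike.exists_of_lt (hf k)
  -- the diagonal tuple and an index at which its retraction vanishes
  let X : n → ULift.{u} ℕ → H := fun j k => x k.down j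
  obtain ⟨m, hm⟩ : ∃ m : ℕ, ∀ j, r (X j) ⟨m⟩ = 0 := by
    classical
    obtain ⟨m, hm⟩ := Infinite.exists_notMem_finset
      (Finset.univ.biUnion fun j => (r (X j)).support)
    refine ⟨m.down, fun j => by_contra fun h => hm ?_⟩
    exact Finset.mem_biUnion.2 ⟨j, Finset.mem_univ _, Finsupp.mem_support_iff.2 h⟩
  -- the diagonal tuple is a finitely supported tuple, fixed by `r`, plus a solution of `f (m + 1)`
  let Y : n → ULift.{u} ℕ →₀ H := fun j => Finsupp.onFinset
    ((Finset.range (m + 1)).map Equiv.ulift.symm.toEmbedding)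
    (fun k => if k.down ≤ m then x k.down j else 0) (fun k hk => by
      have : k.down ≤ m := by_contra fun h => hk (if_neg h)
      simpa [ULift.ext_iff] using Nat.lt_succ_of_le this)
  let Z : n → ULift.{u} ℕ → H := fun j k => if k.down ≤ m then 0 else x k.down j
  have hXYZ : ∀ j, X j = Finsupp.lcoeFun (R := A) (Y j) + Z j := by
    intro j
    ext k
    by_cases h : k.down ≤ m <;> simp [X, Y, Z, h]
  have hZ : Z ∈ (f (m + 1)).sol (ULift.{u} ℕ → H) := by
    refine PPFormula.mem_sol_pi.2 fun k => ?_
    by_cases h : k.down ≤ m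
    · simp only [Z, h, if_true]
      exact AddSubgroup.zero_mem _
    · simp only [Z, h, if_false]
      exact hanti (Nat.succ_le_of_lt (not_le.1 h)) (hx k.down)
  have hrZ := PPFormula.map_mem_sol (Finsupp.lapply (R := A) (⟨m⟩ : ULift.{u} ℕ) ∘ₗ r) hZ
  apply hx' m
  have heq : x m = -fun j => (Finsupp.lapply (R := A) (⟨m⟩ : ULift.{u} ℕ) ∘ₗ r) (Z j) := by
    ext j
    have h₁ := hm j
    rw [hXYZ, map_add, ← LinearMap.comp_apply, hr, LinearMap.id_apply, Finsupp.add_apply] at h₁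
    have h₂ : Y j ⟨m⟩ = x m j := by simp [Y]
    rw [h₂] at h₁
    exact eq_neg_of_add_eq_zero_left h₁
  rw [heq]
  exact neg_mem hrZ

end Chain

/-! ### Algebraic compactness and pure-injectivity -/

section AlgebraicallyCompact

variable {A : Type u} [Ring A]

/-- The subgroup of `N` that a formula in one free variable defines. -/
def PPFormula.solOne (φ : PPFormula A Unit) (N : Type*) [AddCommGroup N] [Module A N] :
    AddSubgroup N :=
  (φ.sol N).comap (Pi.constAddMonoidHom Unit N)

theorem PPFormula.mem_solOne {φ : PPFormula A Unit} {N : Type*} [AddCommGroup N] [Module A N]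
    {x : N} : x ∈ φ.solOne N ↔ (fun _ => x) ∈ φ.sol N := Iff.rfl

theorem PPFormula.solOne_le_iff {φ ψ : PPFormula A Unit} {N : Type*} [AddCommGroup N]
    [Module A N] : φ.solOne N ≤ ψ.solOne N ↔ φ.sol N ≤ ψ.sol N :=
  ⟨fun h x hx => h (x := x ()) hx, fun h _ hx => h hx⟩

/-- `C` is the coset `c + φ(N)`. -/
def IsPPCoset {N : Type*} [AddCommGroup N] [Module A N] (C : Set N) (φ : PPFormula A Unit)
    (c : N) : Prop :=
  ∀ y, y ∈ C ↔ y - c ∈ φ.solOne N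

/-- Every nonempty downward directed family of cosets of definable subgroups has a common
element. -/
def IsAlgebraicallyCompact (A : Type u) [Ring A] (N : Type*) [AddCommGroup N] [Module A N] :
    Prop :=
  ∀ 𝒞 : Set (Set N), 𝒞.Nonempty →
    (∀ C ∈ 𝒞, ∃ (φ : PPFormula A Unit) (c : N), IsPPCoset C φ c) →
    (∀ C ∈ 𝒞, ∀ D ∈ 𝒞, ∃ E ∈ 𝒞, E ⊆ C ∩ D) → ∃ y, ∀ C ∈ 𝒞, y ∈ C

theorem PPDescending.isAlgebraicallyCompact {N : Type*} [AddCommGroup N] [Module A N]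
    (h : PPDescending A Unit N) : IsAlgebraicallyCompact A N := by
  rintro 𝒞 ⟨C₁, hC₁⟩ hcos hdir
  obtain ⟨φ₁, c₁, h₁⟩ := hcos C₁ hC₁
  obtain ⟨φ, ⟨C, hC, c, hφ⟩, hmin⟩ :=
    h.has_min {φ | ∃ C ∈ 𝒞, ∃ c, IsPPCoset C φ c} ⟨φ₁, C₁, hC₁, c₁, h₁⟩
  refine ⟨c, fun D hD => ?_⟩
  obtain ⟨E, hE, hsub⟩ := hdir C hC D hD
  obtain ⟨ψ, e, hψ⟩ := hcos E hE
  have hle : ψ.solOne N ≤ φ.solOne N := by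
    intro y hy
    have h₁ := (hφ _).1 (hsub ((hψ (y + e)).2 (by simpa using hy))).1
    have h₂ := (hφ _).1 (hsub ((hψ e).2 (by simp))).1
    have := sub_mem h₁ h₂
    rwa [sub_sub_sub_cancel_right, add_sub_cancel_right] at this
  have hge : φ.solOne N ≤ ψ.solOne N := by
    by_contra hn
    exact hmin ψ ⟨E, hE, e, hψ⟩ (lt_of_le_not_ge (PPFormula.solOne_le_iff.1 hle)
      fun h' => hn (PPFormula.solOne_le_iff.2 h'))
  have h₂ := (hφ _).1 (hsub ((hψ e).2 (by simp))).1
  refine (hsub ((hψ c).2 (hge ?_))).2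
  rw [← neg_sub]
  exact neg_mem h₂

/-- A directed family of cosets of definable subgroups of a dual module is a compatible family
of characters on a directed family of subgroups of `N`, and these have a common extension. -/
theorem CharDuality.isAlgebraicallyCompact {A' : Type u} [Ring A'] {σ : A ≃ A'} {N N' : Type*}
    [AddCommGroup N] [Module A N] [AddCommGroup N'] [Module A' N'] (D : CharDuality σ N N') :
    IsAlgebraicallyCompact A' N' := by
  classical
  rintro 𝒞 ⟨C₁, hC₁⟩ hcos hdir
  have : Nonempty (PPFormula A' Unit) := ⟨(hcos C₁ hC₁).choose⟩
  choose! φ c hφ using hcos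
  let K : 𝒞 → AddSubgroup N := fun C => ((φ C).dual σ.symm).solOne N
  -- membership in a coset is a condition on the restriction to `K C`
  have hmem : ∀ (C : 𝒞) (y : N'), y ∈ C.1 ↔ ∀ z ∈ K C, D.e y z = D.e (c C) z := by
    intro C y
    rw [hφ C C.2, PPFormula.mem_solOne, PPFormula.mem_sol_iff_pair_dual_eq_zero D]
    constructor
    · intro h z hz
      have := h (fun _ => z) hz
      simpa [CharDuality.pair_apply, sub_eq_zero] using this
    · intro h z hz
      have := h (z ()) hz
      simpa [CharDuality.pair_apply, sub_eq_zero] using this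
  let f : (⨁ C, K C) →+ N := DirectSum.toAddMonoid fun C => (K C).subtype
  let χ : (⨁ C, K C) →+ AddCircle (1 : ℚ) :=
    DirectSum.toAddMonoid fun C => (D.e (c C)).comp (K C).subtype
  have hχ : ∀ g, ∃ E : 𝒞, ∀ E' : 𝒞, E'.1 ⊆ E.1 → χ g = D.e (c E') (f g) := by
    intro g
    induction g using DirectSum.induction_on with
    | zero => exact ⟨⟨C₁, hC₁⟩, by simp⟩
    | of C z =>
      refine ⟨C, fun E' h => ?_⟩
      have hc : c E' ∈ E'.1 := (hφ E' E'.2 _).2 (by simp)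
      simpa [χ, f] using ((hmem C _).1 (h hc) z z.2).symm
    | add g g' hg hg' =>
      obtain ⟨E, hE⟩ := hg
      obtain ⟨E', hE'⟩ := hg'
      obtain ⟨F, hF, hsub⟩ := hdir E E.2 E' E'.2
      refine ⟨⟨F, hF⟩, fun E'' h => ?_⟩
      rw [map_add, map_add, map_add, hE E'' fun y hy => (hsub (h hy)).1,
        hE' E'' fun y hy => (hsub (h hy)).2]
  obtain ⟨χ', hχ'⟩ := exists_character_comp_eq f χ fun g hg => by
    obtain ⟨E, hE⟩ := hχ g
    rw [hE E subset_rfl, hg, map_zero]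
  refine ⟨D.e.symm χ', fun C hC => (hmem ⟨C, hC⟩ _).2 fun z hz => ?_⟩
  have := hχ' (DirectSum.of (fun C => K C) ⟨C, hC⟩ ⟨z, hz⟩)
  simpa [χ, f] using this

end AlgebraicallyCompact

section Extension

variable {A : Type u} [Ring A] {L H : Type u} [AddCommGroup L] [Module A L] [AddCommGroup H]
  [Module A H]

/-- The relation `G` from `L` to `H` carries the constants of every finite system of equations
solvable in `L` to the constants of a system solvable in `H`. Such a relation is the graph of a
partial map. -/
def IsPureGraph (G : Submodule A (L × H)) : Prop :=
  ∀ (m k : Type) [Fintype m] [Fintype k] (a : Matrix m k A) (g : m → L × H), (∀ i, g i ∈ G) →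
    (∃ y : k → L, act a y = fun i => (g i).1) → ∃ z : k → H, act a z = fun i => (g i).2

theorem IsPureGraph.snd_eq_zero {G : Submodule A (L × H)} (hG : IsPureGraph G) {g : L × H}
    (hg : g ∈ G) (h : g.1 = 0) : g.2 = 0 := by
  obtain ⟨z, hz⟩ := hG Unit Empty 0 (fun _ => g) (fun _ => hg) ⟨0, by ext; simp [h]⟩
  simpa using (congrFun hz ()).symm

/-- If `H` is algebraically compact, then a pure graph can be enlarged by a value at any given
element. -/
theorem IsPureGraph.exists_extension (hH : IsAlgebraicallyCompact A H) {G : Submodule A (L × H)}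
    (hG : IsPureGraph G) (x : L) :
    ∃ y : H, IsPureGraph (G ⊔ Submodule.span A {(x, y)}) := by
  -- each system with constants `g + s x` that is solvable in `L` asks for `y` in a certain coset
  let 𝒞 : Set (Set H) := {C | ∃ (m k : Type) (_ : Fintype m) (_ : Fintype k) (a : Matrix m k A)
    (g : m → L × H) (s : m → A), (∀ i, g i ∈ G) ∧
      (∃ z : k → L, act a z = fun i => (g i).1 + s i • x) ∧
      C = {y | ∃ z : k → H, act a z = fun i => (g i).2 + s i • y}}
  suffices hex : ∃ y, ∀ C ∈ 𝒞, y ∈ C by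
    obtain ⟨y, hy⟩ := hex
    refine ⟨y, fun m k _ _ a g hg hsol => ?_⟩
    choose g' hg' s' hs hgs using fun i => Submodule.mem_sup.1 (hg i)
    choose s hs using fun i => Submodule.mem_span_singleton.1 (hs i)
    have hgs' : ∀ i, g i = g' i + s i • (x, y) := fun i => by rw [hs, hgs]
    have := hy _ ⟨m, k, inferInstance, inferInstance, a, g', s, hg', by
      simpa [hgs'] using hsol, rfl⟩
    simpa [hgs'] using this
  refine hH 𝒞
    ⟨_, Empty, Empty, inferInstance, inferInstance, 0, Empty.elim, Empty.elim, by simp,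
      ⟨0, by ext i; exact i.elim⟩, rfl⟩ ?_ ?_
  · -- such a set of values is nonempty because `G` is pure, hence a coset
    rintro C ⟨m, k, _, _, a, g, s, hg, ⟨z, hz⟩, rfl⟩
    obtain ⟨w, hw⟩ := hG m (k ⊕ Unit) (Matrix.fromCols a (Matrix.of fun i _ => -s i)) g hg
      ⟨Sum.elim z fun _ => x, by
        rw [act_fromCols]
        ext i
        simpa [act_apply, ← sub_eq_add_neg, sub_eq_iff_eq_add] using congrFun hz i⟩
    have hw' : act a (w ∘ Sum.inl) = fun i => (g i).2 + s i • w (Sum.inr ()) := by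
      rw [act_fromCols] at hw
      ext i
      simpa [act_apply, ← sub_eq_add_neg, sub_eq_iff_eq_add] using congrFun hw i
    refine ⟨⟨k, m, Matrix.of fun i _ => s i, a⟩, w (Sum.inr ()), fun y => ?_⟩
    rw [PPFormula.mem_solOne, PPFormula.mem_sol]
    constructor
    · rintro ⟨z, hz⟩
      refine ⟨w ∘ Sum.inl - z, ?_⟩
      rw [map_sub, hz, hw']
      ext i
      simp [act_apply, smul_sub]
    · rintro ⟨z, hz⟩
      refine ⟨w ∘ Sum.inl - z, ?_⟩
      rw [map_sub, hw']
      ext i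
      have := congrFun hz i
      simp only [act_apply, Pi.add_apply, Matrix.of_apply, Finset.univ_unique, Finset.sum_const,
        Finset.card_singleton, one_smul, Pi.zero_apply, smul_sub] at this
      rw [add_comm, ← eq_neg_iff_add_eq_zero] at this
      simp only [Pi.sub_apply, act_apply, this]
      abel
  · rintro _ ⟨m, k, _, _, a, g, s, hg, ⟨z, hz⟩, rfl⟩ _
      ⟨m', k', _, _, a', g', s', hg', ⟨z', hz'⟩, rfl⟩
    refine ⟨_, ⟨m ⊕ m', k ⊕ k', inferInstance, inferInstance,
      Matrix.fromRows (Matrix.fromCols a 0) (Matrix.fromCols 0 a'), Sum.elim g g', Sum.elim s s',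
      by simp [hg, hg'], ⟨Sum.elim z z', ?_⟩, rfl⟩, ?_⟩
    · rw [act_fromRows, act_fromCols, act_fromCols]
      ext (i | i)
      · simpa using congrFun hz i
      · simpa using congrFun hz' i
    · rintro y ⟨w, hw⟩
      rw [act_fromRows, act_fromCols, act_fromCols] at hw
      refine ⟨⟨w ∘ Sum.inl, ?_⟩, ⟨w ∘ Sum.inr, ?_⟩⟩
      · ext i
        simpa using congrFun hw (Sum.inl i)
      · ext i
        simpa using congrFun hw (Sum.inr i)

theorem IsAlgebraicallyCompact.exists_extension (hH : IsAlgebraicallyCompact A H) {N : Type u}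
    [AddCommGroup N] [Module A N] {f : N →ₗ[A] L} (hf : IsPureMono f) (g : N →ₗ[A] H) :
    ∃ h : L →ₗ[A] H, h ∘ₗ f = g := by
  have h₀ : IsPureGraph (LinearMap.range (f.prod g)) := by
    intro m k _ _ a c hc hsol
    choose b hb using hc
    obtain ⟨x, hx⟩ := isPureMono_iff.1 hf m k a b (by simpa [← hb] using hsol)
    refine ⟨fun j => g (x j), ?_⟩
    rw [act_comp, hx]
    ext i
    simp [← hb]
  obtain ⟨G, hle, hG⟩ := zorn_le_nonempty₀ {G : Submodule A (L × H) | IsPureGraph G}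
    (fun c hc hchain G₁ hG₁ => by
      refine ⟨sSup c, fun m k _ _ a g hg hsol => ?_, fun _ => le_sSup⟩
      have hdir := hchain.directedOn
      choose F hF hgF using fun i => (Submodule.mem_sSup_of_directed ⟨G₁, hG₁⟩ hdir).1 (hg i)
      have : Nonempty c := ⟨⟨G₁, hG₁⟩⟩
      classical
      obtain ⟨⟨E, hE⟩, hEF⟩ := (directedOn_iff_directed.1 hdir).finset_le
        (Finset.univ.image fun i => (⟨F i, hF i⟩ : c))
      exact hc hE m k a g (fun i => hEF ⟨F i, hF i⟩
        (Finset.mem_image_of_mem _ (Finset.mem_univ i)) (hgF i)) hsol) _ h₀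
  have hpure : IsPureGraph G := hG.prop
  have hbij : Function.Bijective (LinearMap.fst A L H ∘ₗ G.subtype) := by
    constructor
    · rw [injective_iff_map_eq_zero]
      rintro ⟨p, hp⟩ h
      exact Subtype.ext (Prod.ext h (hpure.snd_eq_zero hp h))
    · intro x
      obtain ⟨y, hy⟩ := hpure.exists_extension hH x
      have := hG.le_of_ge hy le_sup_left
        (Submodule.mem_sup_right (Submodule.mem_span_singleton_self (x, y)))
      exact ⟨⟨_, this⟩, rfl⟩
  let e := LinearEquiv.ofBijective _ hbij
  refine ⟨LinearMap.snd A L H ∘ₗ G.subtype ∘ₗ e.symm.toLinearMap, LinearMap.ext fun x => ?_⟩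
  have hx : e.symm (f x) = ⟨(f x, g x), hle ⟨x, rfl⟩⟩ := by
    rw [LinearEquiv.symm_apply_eq]
    rfl
  simp [hx]

theorem IsAlgebraicallyCompact.isPureInjective {H : ModuleCat.{u} A}
    (hH : IsAlgebraicallyCompact A H) : IsPureInjective H :=
  fun _ _ _ hf g => hH.exists_extension hf g

theorem IsPureInjective.of_leftInverse {N L : ModuleCat.{u} A} (hL : IsPureInjective L)
    {s : N →ₗ[A] L} {r : L →ₗ[A] N} (h : r ∘ₗ s = LinearMap.id) : IsPureInjective N := by
  intro N' L' f hf g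
  obtain ⟨g', hg'⟩ := hL N' L' f hf (s ∘ₗ g)
  exact ⟨r ∘ₗ g', by rw [LinearMap.comp_assoc, hg', ← LinearMap.comp_assoc, h, LinearMap.id_comp]⟩

theorem IsPureInjective.pi {ι : Type u} {Y : ι → ModuleCat.{u} A}
    (h : ∀ i, IsPureInjective (Y i)) : IsPureInjective (ModuleCat.of A (∀ i, Y i)) := by
  intro N L f hf g
  choose g' hg' using fun i => h i N L f hf (LinearMap.proj i ∘ₗ g)
  refine ⟨LinearMap.pi g', LinearMap.ext fun x => funext fun i => ?_⟩
  exact LinearMap.congr_fun (hg' i) x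

end Extension

/-! ### Definable subgroups and submodules over the endomorphism ring -/

section EndLength

variable {A : Type u} [Ring A]

/-- A pure-injective module has an endomorphism that maps `h` to `h'` as soon as `h'` satisfies
all positive primitive formulas satisfied by `h`: this is the purity of the second summand in the
amalgam of `H` and `H` along `h = h'`. -/
theorem IsPureInjective.exists_end_apply_eq {H : ModuleCat.{u} A} (hH : IsPureInjective H)
    {h h' : H} (hle : ∀ φ : PPFormula A Unit, h ∈ φ.solOne H → h' ∈ φ.solOne H) :
    ∃ g : H →ₗ[A] H, g h = h' := by
  let W : Submodule A (H × H) := Submodule.span A {(h, -h')}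
  have hpure : IsPureMono (W.mkQ ∘ₗ LinearMap.inr A H H) := by
    refine isPureMono_iff.2 fun m k _ _ a b => ?_
    rintro ⟨y, hy⟩
    choose Y hY using fun j => W.mkQ_surjective (y j)
    have hmem : ∀ i, ∃ s : A, s • (h, -h') = act a Y i - (0, b i) := by
      intro i
      refine Submodule.mem_span_singleton.1 ((Submodule.Quotient.eq W).1 ?_)
      have h₁ := congrFun (act_comp W.mkQ a Y) i
      simp only [hY, hy] at h₁
      exact h₁.symm
    choose s hs using hmem
    have h₁ : ∀ i, s i • h = act a (fun j => (Y j).1) i := by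
      intro i
      have := congrArg (LinearMap.fst A H H) (hs i)
      rw [map_sub, ← congrFun (act_comp (LinearMap.fst A H H) a Y) i] at this
      simpa using this
    have h₂ : ∀ i, -(s i • h') = act a (fun j => (Y j).2) i - b i := by
      intro i
      have := congrArg (LinearMap.snd A H H) (hs i)
      rw [map_sub, ← congrFun (act_comp (LinearMap.snd A H H) a Y) i] at this
      simpa using this
    obtain ⟨z, hz⟩ := hle ⟨k, m, Matrix.of fun i _ => s i, a⟩ ⟨-fun j => (Y j).1, by
      ext i
      have := h₁ i
      rw [map_neg]
      simp [act_apply, this]⟩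
    refine ⟨(fun j => (Y j).2) - z, ?_⟩
    ext i
    have h₃ : s i • h' + act a z i = 0 := by simpa [act_apply] using congrFun hz i
    have h₄ := h₂ i
    rw [map_sub, Pi.sub_apply, eq_neg_of_add_eq_zero_right h₃, h₄]
    abel
  obtain ⟨g, hg⟩ := hH H (ModuleCat.of A ((H × H) ⧸ W)) _ hpure LinearMap.id
  refine ⟨g ∘ₗ W.mkQ ∘ₗ LinearMap.inl A H H, ?_⟩
  have hrel : W.mkQ (h, 0) = W.mkQ (0, h') :=
    (Submodule.Quotient.eq W).2 (by simp [W])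
  calc g (W.mkQ (h, 0)) = g (W.mkQ (0, h')) := by rw [hrel]
    _ = h' := LinearMap.congr_fun hg h'

/-- Under both chain conditions, the endosubmodules of a pure-injective module are exactly its
definable subgroups. -/
theorem IsPureInjective.exists_solOne_eq {H : ModuleCat.{u} A} (hH : IsPureInjective H)
    (hd : PPDescending A Unit H) (ha : PPAscending A Unit H)
    (P : Submodule (Module.End A H) H) :
    ∃ φ : PPFormula A Unit, φ.solOne H = P.toAddSubgroup := by
  have hend : ∀ (φ : PPFormula A Unit) (g : Module.End A H) (x : H), x ∈ φ.solOne H →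
      g • x ∈ φ.solOne H := fun φ g x hx => PPFormula.map_mem_sol g hx
  -- the least definable subgroup that contains `h` is the endosubmodule generated by `h`
  have hcyc : ∀ h : H, ∃ φ : PPFormula A Unit,
      h ∈ φ.solOne H ∧ ∀ x ∈ φ.solOne H, ∃ g : Module.End A H, g • h = x := by
    intro h
    obtain ⟨φ, hφ, hmin⟩ := hd.has_min {φ | h ∈ φ.solOne H}
      ⟨⟨Empty, Empty, 0, 0⟩, 0, by ext i; exact i.elim⟩
    refine ⟨φ, hφ, fun x hx => hH.exists_end_apply_eq fun ψ hψ => ?_⟩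
    by_contra hn
    refine hmin (ψ.inf φ) (PPFormula.mem_sol_inf.2 ⟨hψ, hφ⟩) (lt_of_le_not_ge
      (fun y hy => (PPFormula.mem_sol_inf.1 hy).2) fun hle => ?_)
    exact hn (PPFormula.mem_sol_inf.1 (hle hx)).1
  have hcyc' : ∀ h ∈ P, ∃ φ : PPFormula A Unit, h ∈ φ.solOne H ∧ ∀ x ∈ φ.solOne H, x ∈ P := by
    intro h hh
    obtain ⟨φ, h₁, h₂⟩ := hcyc h
    refine ⟨φ, h₁, fun x hx => ?_⟩
    obtain ⟨g, rfl⟩ := h₂ x hx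
    exact P.smul_mem g hh
  -- a maximal definable subgroup inside `P` absorbs all cyclic endosubmodules of `P`
  obtain ⟨φ₀, -, h₀⟩ := hcyc' 0 P.zero_mem
  obtain ⟨φ, hφ, hmax⟩ := ha.has_min {φ | ∀ x ∈ φ.solOne H, x ∈ P} ⟨φ₀, h₀⟩
  refine ⟨φ, le_antisymm hφ fun h hh => ?_⟩
  obtain ⟨ψ, h₁, h₂⟩ := hcyc' h hh
  by_contra hn
  refine hmax (φ.sup ψ) (fun x hx => ?_) ?_
  · rw [PPFormula.mem_solOne, PPFormula.sol_sup, AddSubgroup.mem_sup] at hx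
    obtain ⟨v, hv, w, hw, hvw⟩ := hx
    rw [← congrFun hvw ()]
    exact P.add_mem (hφ _ hv) (h₂ _ hw)
  · rw [PPFormula.sol_sup]
    exact lt_of_le_not_ge le_sup_left fun hle =>
      hn (hle (le_sup_right (a := φ.sol H) (b := ψ.sol H) h₁))

theorem IsPureInjective.isFiniteLength_end {H : ModuleCat.{u} A} (hH : IsPureInjective H)
    (hd : PPDescending A Unit H) (ha : PPAscending A Unit H) :
    IsFiniteLength (Module.End A H) H := by
  choose φ hφ using hH.exists_solOne_eq hd ha
  have hlt : ∀ {P Q : Submodule (Module.End A H) H}, P < Q → (φ P).sol H < (φ Q).sol H := by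
    intro P Q hPQ
    rw [lt_iff_le_not_ge, ← PPFormula.solOne_le_iff, ← PPFormula.solOne_le_iff, hφ, hφ,
      ← lt_iff_le_not_ge]
    exact hPQ
  rw [isFiniteLength_iff_isNoetherian_isArtinian]
  refine ⟨isNoetherian_iff.2 ?_, ?_⟩
  · exact Subrelation.wf (fun {P Q} (h : P > Q) => hlt h) (InvImage.wf φ ha)
  · exact ⟨Subrelation.wf (fun {P Q} (h : P < Q) => hlt h) (InvImage.wf φ hd)⟩

/-- The subgroup of `H^n` defined by a formula, as a submodule over the endomorphism ring. -/
def PPFormula.solSubmodule {n : Type} [Fintype n] (φ : PPFormula A n) (H : Type u)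
    [AddCommGroup H] [Module A H] : Submodule (Module.End A H) (n → H) :=
  { φ.sol H with smul_mem' := fun g _ hx => PPFormula.map_mem_sol g hx }

theorem ppDescending_of_isFiniteLength_end (n : Type) [Fintype n] {H : Type u} [AddCommGroup H]
    [Module A H] (h : IsFiniteLength (Module.End A H) H) : PPDescending A n H := by
  obtain ⟨_, _⟩ := isFiniteLength_iff_isNoetherian_isArtinian.1 h
  exact InvImage.wf (fun φ : PPFormula A n => φ.solSubmodule H)
    (wellFounded_lt (α := Submodule (Module.End A H) (n → H)))

theorem ppAscending_of_isFiniteLength_end (n : Type) [Fintype n] {H : Type u} [AddCommGroup H]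
    [Module A H] (h : IsFiniteLength (Module.End A H) H) : PPAscending A n H := by
  obtain ⟨_, _⟩ := isFiniteLength_iff_isNoetherian_isArtinian.1 h
  exact InvImage.wf (fun φ : PPFormula A n => φ.solSubmodule H)
    (wellFounded_gt (α := Submodule (Module.End A H) (n → H)))

end EndLength

/-! ### Closure properties of `Prod` and `Prod⁺` -/

section ProdClosure

variable {A : Type u} [Ring A] {X : ObjectProperty (ModuleCat.{u} A)}

theorem prodPlusClosure_of_isPureMono {N L : ModuleCat.{u} A} {f : N →ₗ[A] L} (hf : IsPureMono f)
    (hL : prodPlusClosure X L) : prodPlusClosure X N := by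
  obtain ⟨ι, Y, hY, g, hg⟩ := hL
  exact ⟨ι, Y, hY, g ∘ₗ f, hg.comp hf⟩

theorem prodPlusClosure_of_mem {N : ModuleCat.{u} A} (hN : X N) : prodPlusClosure X N :=
  ⟨PUnit, fun _ => N, fun _ => hN, LinearMap.pi fun _ => LinearMap.id,
    isPureMono_of_leftInverse (r := LinearMap.proj PUnit.unit) rfl⟩

theorem prodPlusClosure_pi {κ : Type u} {N : κ → ModuleCat.{u} A}
    (h : ∀ k, prodPlusClosure X (N k)) : prodPlusClosure X (ModuleCat.of A (∀ k, N k)) := by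
  choose ι Y hY f hf using h
  refine ⟨Σ k, ι k, fun p => Y p.1 p.2, fun p => hY p.1 p.2,
    LinearMap.pi fun p => LinearMap.proj p.2 ∘ₗ f p.1 ∘ₗ LinearMap.proj p.1, ?_⟩
  refine isPureMono_iff_sol.2 fun n _ φ x hx => PPFormula.mem_sol_pi.2 fun k =>
    isPureMono_iff_sol.1 (hf k) n φ _ (PPFormula.mem_sol_pi.2 fun i => ?_)
  exact PPFormula.mem_sol_pi.1 hx ⟨k, i⟩

theorem prodPlusClosure_of_prodClosure {X' : ObjectProperty (ModuleCat.{u} A)}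
    (h : ∀ N, X' N → prodPlusClosure X N) {N : ModuleCat.{u} A} (hN : prodClosure X' N) :
    prodPlusClosure X N := by
  obtain ⟨ι, Y, hY, s, r, hrs⟩ := hN
  exact prodPlusClosure_of_isPureMono (L := ModuleCat.of A (∀ i, Y i))
    (isPureMono_of_leftInverse hrs) (prodPlusClosure_pi fun i => h _ (hY i))

theorem inDefinableClosure_of_prodPlusClosure {M : Type u} [AddCommGroup M] [Module A M]
    (h : ∀ Y : ModuleCat.{u} A, X Y → InDefinableClosure A M Y) {N : ModuleCat.{u} A}
    (hN : prodPlusClosure X N) : InDefinableClosure A M N := by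
  obtain ⟨ι, Y, hY, f, hf⟩ := hN
  exact (InDefinableClosure.pi fun i => h _ (hY i)).trans (.of_isPureMono hf)

theorem isPureInjective_of_prodClosure (h : ∀ Y, X Y → IsPureInjective Y) {N : ModuleCat.{u} A}
    (hN : prodClosure X N) : IsPureInjective N := by
  obtain ⟨ι, Y, hY, s, r, hrs⟩ := hN
  exact IsPureInjective.of_leftInverse (L := ModuleCat.of A (∀ i, Y i))
    (IsPureInjective.pi fun i => h _ (hY i)) hrs

/-- A pure submodule that is pure-injective is a direct summand. -/
theorem IsPureInjective.exists_retraction {N : ModuleCat.{u} A} (hN : IsPureInjective N)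
    {L : Type u} [AddCommGroup L] [Module A L] {f : N →ₗ[A] L} (hf : IsPureMono f) :
    ∃ r : L →ₗ[A] N, r ∘ₗ f = LinearMap.id :=
  hN N (ModuleCat.of A L) f hf LinearMap.id

theorem ppDescending_of_isPureInjective_finsupp {H : Type u} [AddCommGroup H] [Module A H]
    (h : IsPureInjective (ModuleCat.of A (ULift.{u} ℕ →₀ H))) (n : Type) [Fintype n] :
    PPDescending A n H := by
  obtain ⟨r, hr⟩ := h.exists_retraction (isPureMono_finsupp (A := A) (N := H) (ULift.{u} ℕ))
  exact .of_retraction r hr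

end ProdClosure

/-! ### Pure covers and duals -/

section Cover

variable {R : Type u} [Ring R]

/-- Every solution in `N` of a positive primitive formula is a sum of images of solutions in the
`X j`; in other words, the sum `⨁ X j → N` of the maps `t j` is a pure epimorphism. -/
def IsPPCover {J : Type*} {X : J → Type*} [∀ j, AddCommGroup (X j)] [∀ j, Module R (X j)]
    {N : Type*} [AddCommGroup N] [Module R N] (t : ∀ j, X j →ₗ[R] N) : Prop :=
  ∀ (n : Type) [Fintype n] (φ : PPFormula R n), ∀ x ∈ φ.sol N,
    x ∈ AddSubgroup.closure {w | ∃ j, ∃ z ∈ φ.sol (X j), w = fun k => t j (z k)}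

section

variable {J : Type*} {X : J → Type*} [∀ j, AddCommGroup (X j)] [∀ j, Module R (X j)]
    {N : Type*} [AddCommGroup N] [Module R N]

theorem isPPCover_of_sum_eq {t : ∀ j, X j →ₗ[R] N} (p : ∀ j, N →ₗ[R] X j)
    (h : ∀ x, ∃ s : Finset J, ∀ s', s ⊆ s' → ∑ j ∈ s', t j (p j x) = x) : IsPPCover t := by
  classical
  intro n _ φ x hx
  choose s hs using h
  have heq : x = ∑ j ∈ Finset.univ.biUnion fun k => s (x k), fun k => t j (p j (x k)) := by
    ext k
    rw [Finset.sum_apply]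
    exact (hs _ _ (Finset.subset_biUnion_of_mem (fun k => s (x k)) (Finset.mem_univ k))).symm
  rw [heq]
  exact sum_mem fun j _ => AddSubgroup.subset_closure
    ⟨j, _, PPFormula.map_mem_sol (p j) hx, rfl⟩

theorem isPPCover_lof {ι : Type*} [DecidableEq ι] (X : ι → Type*) [∀ i, AddCommGroup (X i)]
    [∀ i, Module R (X i)] : IsPPCover (DirectSum.lof R ι X) := by
  classical
  refine isPPCover_of_sum_eq (DirectSum.component R ι X) fun x => ⟨DFinsupp.support x,
    fun s' hs' => ?_⟩
  refine (Finset.sum_subset hs' fun i _ hi => ?_).symm.trans (DirectSum.sum_support_of x)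
  have hx : DirectSum.component R ι X i x = 0 := DFinsupp.notMem_support_iff.1 hi
  rw [hx, map_zero]

theorem isPPCover_lsingle (κ : Type*) :
    IsPPCover fun k : κ => (Finsupp.lsingle k : N →ₗ[R] (κ →₀ N)) := by
  classical
  refine isPPCover_of_sum_eq Finsupp.lapply fun x => ⟨x.support, fun s' hs' => ?_⟩
  ext i
  rw [Finsupp.finsetSum_apply]
  simp only [Finsupp.lapply_apply, Finsupp.lsingle_apply, Finsupp.single_apply,
    Finset.sum_ite_eq']
  refine ite_eq_left_iff.2 fun hi => ?_
  exact (Finsupp.notMem_support_iff.1 fun h => hi (hs' h)).symm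

theorem IsPPCover.comp {K : J → Type*} {Y : ∀ j, K j → Type*} [∀ j k, AddCommGroup (Y j k)]
    [∀ j k, Module R (Y j k)] {t : ∀ j, X j →ₗ[R] N} (ht : IsPPCover t)
    {t' : ∀ j k, Y j k →ₗ[R] X j} (ht' : ∀ j, IsPPCover (t' j)) :
    IsPPCover fun p : Σ j, K j => t p.1 ∘ₗ t' p.1 p.2 := by
  intro n _ φ x hx
  refine (AddSubgroup.closure_le _).2 ?_ (ht n φ x hx)
  rintro _ ⟨j, z, hz, rfl⟩
  refine (AddSubgroup.closure_le (AddSubgroup.comap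
    ((t j).toAddMonoidHom.compLeft n) (AddSubgroup.closure _))).2 ?_ (ht' j n φ z hz)
  rintro _ ⟨k, v, hv, rfl⟩
  exact AddSubgroup.subset_closure ⟨⟨j, k⟩, v, hv, rfl⟩

end

/-- The map `L^* → N^*` induced by `t : N → L`. -/
def dualMapOfLeft {N L : ModuleCat.{u} R} (t : N →ₗ[R] L) :
    dualOfLeft L →ₗ[Rᵐᵒᵖ] dualOfLeft N where
  toFun f := AddMonoidHom.comp (show L →+ AddCircle (1 : ℚ) from f) t.toAddMonoidHom
  map_add' _ _ := rfl
  map_smul' r f := CharacterModule.ext _ fun x =>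
    congrArg (show L →+ AddCircle (1 : ℚ) from f) (map_smul t r.unop x).symm

/-- The dual of a pure epimorphism `⨁ X j → N` is a pure monomorphism `N^* → ∏ (X j)^*`. -/
theorem IsPPCover.prodPlusClosure_dual {B : ObjectProperty (ModuleCat.{u} R)} {J : Type u}
    {X : J → ModuleCat.{u} R} (hX : ∀ j, B (X j)) {N : ModuleCat.{u} R} {t : ∀ j, X j →ₗ[R] N}
    (ht : IsPPCover t) : prodPlusClosure (dualClassOfLeft B) (dualOfLeft N) := by
  refine ⟨J, fun j => dualOfLeft (X j), fun j => ⟨X j, hX j, ⟨LinearEquiv.refl _ _⟩⟩,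
    LinearMap.pi fun j => dualMapOfLeft (t j), isPureMono_iff_sol.2 fun n _ φ x hx => ?_⟩
  rw [PPFormula.mem_sol_iff_pair_dual_eq_zero (charDualityLeft N)]
  intro z hz
  refine (AddSubgroup.closure_le (AddMonoidHom.ker ((charDualityLeft N).pair x))).2 ?_
    (ht n _ z hz)
  rintro _ ⟨j, v, hv, rfl⟩
  exact (PPFormula.mem_sol_iff_pair_dual_eq_zero (charDualityLeft (X j))).1
    (PPFormula.mem_sol_pi.1 hx j) v hv

theorem prodPlusClosure_dual_directSum {B : ObjectProperty (ModuleCat.{u} R)} {ι : Type u}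
    {X : ι → ModuleCat.{u} R} (hX : ∀ i, B (X i)) :
    prodPlusClosure (dualClassOfLeft B) (dualOfLeft (ModuleCat.of R (⨁ i, X i))) := by
  classical
  exact IsPPCover.prodPlusClosure_dual (N := ModuleCat.of R (⨁ i, X i))
    (t := DirectSum.lof R ι fun i => X i) hX (isPPCover_lof _)

theorem prodPlusClosure_dual_finsupp_directSum {B : ObjectProperty (ModuleCat.{u} R)}
    {ι : Type u} {X : ι → ModuleCat.{u} R} (hX : ∀ i, B (X i)) (κ : Type u) :
    prodPlusClosure (dualClassOfLeft B)
      (dualOfLeft (ModuleCat.of R (κ →₀ ModuleCat.of R (⨁ i, X i)))) := by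
  classical
  have h := (isPPCover_lsingle (R := R) (N := ⨁ i, X i) κ).comp (K := fun _ => ι)
    (Y := fun _ i => X i) (t' := fun _ => DirectSum.lof R ι fun i => X i)
    fun _ => isPPCover_lof _
  exact IsPPCover.prodPlusClosure_dual (J := Σ _ : κ, ι) (X := fun p => X p.2)
    (N := ModuleCat.of R (κ →₀ ⨁ i, X i)) (fun p => hX p.2) h

/-- The positive primitive type of a tuple in a finitely presented module is generated by a
single formula. -/
theorem exists_ppFormula_generating {X : Type u} [AddCommGroup X] [Module R X]
    [Module.FinitePresentation R X] {n : Type} [Fintype n] (b : n → X) :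
    ∃ ψ : PPFormula R n, b ∈ ψ.sol X ∧ ∀ (N : Type u) [AddCommGroup N] [Module R N],
      ∀ v ∈ ψ.sol N, ∃ h : X →ₗ[R] N, v = fun k => h (b k) := by
  classical
  obtain ⟨p, q, f, g, hf, hfg⟩ := Module.FinitePresentation.exists_fin' R X
  choose c hc using fun k => hf (b k)
  let G : Matrix (Fin q) (Fin p) R := Matrix.of fun l => g fun j => if l = j then 1 else 0
  refine ⟨⟨Fin p, n ⊕ Fin q, Matrix.fromRows 1 0, Matrix.fromRows (-Matrix.of c) G⟩, ?_, ?_⟩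
  · refine ⟨fun j => f fun i => if j = i then 1 else 0, ?_⟩
    rw [act_fromRows, act_fromRows, act_one, act_zero_matrix, act_neg_matrix, ← Sum.elim_add_add,
      zero_add, sumElim_eq_zero_iff, ← sub_eq_add_neg, sub_eq_zero]
    constructor
    · ext k
      rw [← hc, f.pi_apply_eq_sum_univ]
      rfl
    · ext l
      refine (f.pi_apply_eq_sum_univ _).symm.trans ?_
      exact hfg.apply_apply_eq_zero _
  · rintro N _ _ v ⟨y, hy⟩
    rw [act_fromRows, act_fromRows, act_one, act_zero_matrix, act_neg_matrix, ← Sum.elim_add_add,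
      zero_add, sumElim_eq_zero_iff, ← sub_eq_add_neg, sub_eq_zero] at hy
    let F : (Fin p → R) →ₗ[R] N := Fintype.linearCombination R y
    have hF : LinearMap.ker f ≤ LinearMap.ker F := by
      intro x hx
      obtain ⟨w, rfl⟩ := (hfg x).1 hx
      change (F ∘ₗ g) w = 0
      rw [LinearMap.pi_apply_eq_sum_univ]
      refine Finset.sum_eq_zero fun l _ => ?_
      have : (F ∘ₗ g) (fun j => if l = j then 1 else 0) = 0 := congrFun hy.2 l
      rw [this, smul_zero]
    refine ⟨(LinearMap.ker f).liftQ F hF ∘ₗ (f.quotKerEquivOfSurjective hf).symm.toLinearMap, ?_⟩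
    rw [hy.1]
    ext k
    have : (f.quotKerEquivOfSurjective hf).symm (b k) = (LinearMap.ker f).mkQ (c k) := by
      rw [LinearEquiv.symm_apply_eq, ← hc]
      rfl
    rw [LinearMap.comp_apply, LinearEquiv.coe_coe, this]
    rfl

/-- Let `M` be a direct sum of finitely presented modules with the ascending chain condition on
definable subgroups. Then `φ(M)` is a finite sum of subgroups `ψ(M)`, where `ψ` generates the type
of a tuple in a summand, and this equality passes to `N`. -/
theorem InDefinableClosure.isPPCover {ι : Type u} {X : ι → ModuleCat.{u} R}
    [∀ i, Module.FinitePresentation R (X i)] {N : ModuleCat.{u} R}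
    (h : InDefinableClosure R (⨁ i, X i) N)
    (hM : ∀ (n : Type) [Fintype n], PPAscending R n (⨁ i, X i)) :
    IsPPCover fun p : Σ i, (X i →ₗ[R] N) => p.2 := by
  classical
  intro n _ φ x hx
  choose ψ hψ hψ' using fun i (b : n → X i) => exists_ppFormula_generating (R := R) b
  let sumOf : List (Σ i, {b : n → X i // b ∈ φ.sol (X i)}) → PPFormula R n :=
    fun l => l.foldr (fun p χ => (ψ p.1 p.2.1).sup χ) (.bot R n)
  -- a finite sum with maximal value in `M` contains every solution of `φ` in a summand
  obtain ⟨_, ⟨l, rfl⟩, hmax⟩ := (hM n).has_min (Set.range sumOf) ⟨_, [], rfl⟩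
  have hle : φ.sol (⨁ i, X i) ≤ (sumOf l).sol (⨁ i, X i) := by
    refine fun v hv => (AddSubgroup.closure_le _).2 ?_ (isPPCover_lof (fun i => X i) n φ v hv)
    rintro _ ⟨i, z, hz, rfl⟩
    by_contra hn
    refine hmax (sumOf (⟨i, z, hz⟩ :: l)) ⟨_, rfl⟩ ?_
    change _ < ((ψ i z).sup (sumOf l)).sol _
    rw [PPFormula.sol_sup]
    exact lt_of_le_not_ge le_sup_right fun hle => hn
      (hle (le_sup_left (α := AddSubgroup (n → ⨁ i, X i))
        (PPFormula.map_mem_sol _ (hψ i z))))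
  have hsum : ∀ l v, v ∈ (sumOf l).sol N → v ∈ AddSubgroup.closure
      {w | ∃ p : Σ i, (X i →ₗ[R] N), ∃ z ∈ φ.sol (X p.1), w = fun k => p.2 (z k)} := by
    intro l
    induction l with
    | nil =>
      intro v hv
      change v ∈ (PPFormula.bot R n).sol N at hv
      rw [PPFormula.sol_bot, AddSubgroup.mem_bot] at hv
      rw [hv]
      exact AddSubgroup.zero_mem _
    | cons p l ih =>
      intro v hv
      change v ∈ ((ψ p.1 p.2.1).sup (sumOf l)).sol N at hv
      rw [PPFormula.sol_sup, AddSubgroup.mem_sup] at hv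
      obtain ⟨v, hv, w, hw, rfl⟩ := hv
      obtain ⟨g, rfl⟩ := hψ' p.1 p.2.1 N v hv
      exact add_mem (AddSubgroup.subset_closure ⟨⟨p.1, g⟩, p.2.1, p.2.2, rfl⟩) (ih w hw)
  exact hsum l x (h n _ _ hle hx)

end Cover

/-! ### The evaluation map into the double dual -/

section DoubleDual

variable {R : Type u} [Ring R]

/-- The evaluation map `N → N^{**}`. -/
def evalDoubleDual (N : ModuleCat.{u} R) : N →ₗ[R] dualOfRight (dualOfLeft N) where
  toFun x := AddMonoidHom.eval (M := N) (N := AddCircle (1 : ℚ)) x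
  map_add' x y := CharacterModule.ext _ fun f => map_add (show N →+ AddCircle (1 : ℚ) from f) x y
  map_smul' _ _ := rfl

theorem isPureMono_evalDoubleDual (N : ModuleCat.{u} R) : IsPureMono (evalDoubleDual N) := by
  refine isPureMono_iff_sol.2 fun n _ φ x hx => ?_
  by_contra hn
  obtain ⟨f, h₁, h₂⟩ := (charDualityLeft N).exists_pair_ne_zero _ hn
  exact h₂ ((PPFormula.mem_sol_iff_pair_dual_eq_zero (charDualityRight (dualOfLeft N))).1 hx f
    ((PPFormula.mem_sol_dual_iff_pair_eq_zero (charDualityLeft N)).2 h₁))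

end DoubleDual

end AlmostDual

/-! ### The equivalence -/

open AlmostDual in
theorem proposition5p4 {R : Type u} [Ring R]
    (B : ObjectProperty (ModuleCat.{u} R)) (hB : AlmostDual.IsAdditiveSubcategory B)
    -- a set of representatives of the isomorphism classes of `B`
    (ι : Type u) (X : ι → ModuleCat.{u} R) (hX : ∀ i, B (X i))
    (hrep : ∀ N : ModuleCat.{u} R, B N → ∃ i, Nonempty (N ≃ₗ[R] X i))
    (S : ObjectProperty (ModuleCat.{u} R)) (P : ObjectProperty (ModuleCat.{u} Rᵐᵒᵖ))
    (hSP : AlmostDual.IsAlmostDualPair S P)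
    (hP : P = AlmostDual.prodPlusClosure (AlmostDual.dualClassOfLeft B)) :
    (P = AlmostDual.prodClosure (AlmostDual.dualClassOfLeft S) ∧
        S = AlmostDual.prodClosure (AlmostDual.dualClassOfRight P)) ↔
      IsFiniteLength
        (Module.End Rᵐᵒᵖ (AlmostDual.dualOfLeft (ModuleCat.of R (⨁ i, X i))))
        (AlmostDual.dualOfLeft (ModuleCat.of R (⨁ i, X i))) := by
  classical
  have hmem := hSP.mem_iff
  have hiso : ∀ {N : ModuleCat.{u} Rᵐᵒᵖ} {L : ModuleCat.{u} Rᵐᵒᵖ}, Nonempty (N ≃ₗ[Rᵐᵒᵖ] L) →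
      P L → P N := by
    rintro N L ⟨e⟩ hL
    rw [hP] at hL ⊢
    exact prodPlusClosure_of_isPureMono (isPureMono_of_linearEquiv e) hL
  let M : ModuleCat.{u} R := ModuleCat.of R (⨁ i, X i)
  have hPM : P (dualOfLeft M) := hP ▸ prodPlusClosure_dual_directSum hX
  constructor
  · rintro ⟨h₁, h₂⟩
    have hPinj : ∀ Y, P Y → IsPureInjective Y := by
      intro Y hY
      rw [h₁] at hY
      refine isPureInjective_of_prodClosure ?_ hY
      rintro Z ⟨N, -, ⟨e⟩⟩
      exact IsPureInjective.of_leftInverse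
        (charDualityLeft N).isAlgebraicallyCompact.isPureInjective
        (s := e.toLinearMap) (r := e.symm.toLinearMap) (by ext; simp)
    have hSinj : ∀ N, S N → IsPureInjective N := by
      intro N hN
      rw [h₂] at hN
      refine isPureInjective_of_prodClosure ?_ hN
      rintro Z ⟨Y, -, ⟨e⟩⟩
      exact IsPureInjective.of_leftInverse
        (charDualityRight Y).isAlgebraicallyCompact.isPureInjective
        (s := e.toLinearMap) (r := e.symm.toLinearMap) (by ext; simp)
    -- `S` and `P` contain the countable direct sums of copies of `M` and of `M^*`
    have hSsum : S (ModuleCat.of R (ULift.{u} ℕ →₀ M)) := by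
      rw [hmem, hP]
      exact prodPlusClosure_dual_finsupp_directSum hX _
    have hPsum : P (ModuleCat.of Rᵐᵒᵖ (ULift.{u} ℕ →₀ dualOfLeft M)) := by
      rw [hP] at hPM ⊢
      exact prodPlusClosure_of_isPureMono
        (L := ModuleCat.of Rᵐᵒᵖ (ULift.{u} ℕ → dualOfLeft M))
        (isPureMono_finsupp _) (prodPlusClosure_pi fun _ => hPM)
    exact (hPinj _ hPM).isFiniteLength_end
      (ppDescending_of_isPureInjective_finsupp (hPinj _ hPsum) Unit)
      (.dual (charDualityLeft M)
        (ppDescending_of_isPureInjective_finsupp (hSinj _ hSsum) Unit))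
  · intro hlen
    -- the `X i` are summands of `M`, so the duals of members of `B` are summands of `M^*`
    have hPcl : ∀ Y, P Y → InDefinableClosure Rᵐᵒᵖ (dualOfLeft M) Y := by
      intro Y hY
      rw [hP] at hY
      refine inDefinableClosure_of_prodPlusClosure ?_ hY
      rintro Z ⟨N, hN, ⟨e⟩⟩
      obtain ⟨i, ⟨e'⟩⟩ := hrep N hN
      have hN : InDefinableClosure R M N := .of_isPureMono
        (f := (DirectSum.lof R ι (fun i => X i) i) ∘ₗ e'.toLinearMap)
        (isPureMono_of_leftInverse
          (r := e'.symm.toLinearMap ∘ₗ DirectSum.component R ι (fun i => X i) i)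
          (by
            ext x
            change e'.symm (DirectSum.component R ι (fun i => X i) i
              (DirectSum.lof R ι (fun i => X i) i (e' x))) = x
            rw [DirectSum.component.lof_self, e'.symm_apply_apply]))
      exact (hN.dual (charDualityLeft M) (charDualityLeft N)).trans
        (.of_isPureMono (isPureMono_of_linearEquiv e))
    have hPinj : ∀ Y, P Y → IsPureInjective Y := fun Y hY =>
      ((ppDescending_of_isFiniteLength_end Unit hlen).of_inDefinableClosure
        (hPcl Y hY)).isAlgebraicallyCompact.isPureInjective
    have hScl : ∀ N, S N → InDefinableClosure R M N := fun N hN =>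
      .of_dual (charDualityLeft M) (charDualityLeft N) (hPcl _ ((hmem N).1 hN))
    have hSinj : ∀ N, S N → IsPureInjective N := fun N hN =>
      ((PPDescending.of_dual (charDualityLeft M)
        (ppAscending_of_isFiniteLength_end Unit hlen)).of_inDefinableClosure
          (hScl N hN)).isAlgebraicallyCompact.isPureInjective
    have hfp : ∀ i, Module.FinitePresentation R (X i) := fun i => hB.finitePresentation _ (hX i)
    -- `S` contains, hence equals, the definable class generated by `M`
    have hclS : ∀ N : ModuleCat.{u} R, InDefinableClosure R M N → S N := by
      intro N hN
      rw [hmem, hP]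
      exact IsPPCover.prodPlusClosure_dual (X := fun p : Σ i, (X i →ₗ[R] N) => X p.1)
        (fun p => hX p.1) (hN.isPPCover fun n _ =>
          .of_dual (charDualityLeft M) (ppDescending_of_isFiniteLength_end n hlen))
    constructor
    · funext Y
      refine propext ⟨fun hY => ?_, fun hY => ?_⟩
      · have hY' := hY
        rw [hP] at hY'
        obtain ⟨κ, Z, hZ, f, hf⟩ := hY'
        obtain ⟨r, hr⟩ := (hPinj Y hY).exists_retraction hf
        refine ⟨κ, Z, fun k => ?_, f, r, hr⟩
        obtain ⟨N, hN, he⟩ := hZ k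
        refine ⟨N, (hmem N).2 ?_, he⟩
        rw [hP]
        exact prodPlusClosure_of_mem ⟨N, hN, ⟨LinearEquiv.refl _ _⟩⟩
      · rw [hP]
        refine prodPlusClosure_of_prodClosure ?_ hY
        rintro Z ⟨N, hN, he⟩
        exact hP ▸ hiso he ((hmem N).1 hN)
    · funext N
      refine propext ⟨fun hN => ?_, fun hN => ?_⟩
      · obtain ⟨r, hr⟩ := (hSinj N hN).exists_retraction (isPureMono_evalDoubleDual N)
        exact ⟨PUnit, fun _ => dualOfRight (dualOfLeft N),
          fun _ => ⟨dualOfLeft N, (hmem N).1 hN, ⟨LinearEquiv.refl _ _⟩⟩,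
          LinearMap.pi fun _ => evalDoubleDual N, r ∘ₗ LinearMap.proj PUnit.unit, hr⟩
      · obtain ⟨κ, Z, hZ, s, r, hrs⟩ := hN
        refine hclS N (.trans (.pi fun k => ?_)
          (.of_isPureMono (isPureMono_of_leftInverse hrs)))
        obtain ⟨Y, hY, ⟨e⟩⟩ := hZ k
        exact ((hPcl Y hY).dual_of_dual (charDualityLeft M) (charDualityRight Y)).trans
          (.of_isPureMono (isPureMono_of_linearEquiv e))
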